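/- Let $L$ be a relational language and $\mathbb X$ an $L$-structure with domain $X$. Suppose that: - $\mathbb X$ is non-constant, i.e. some permutation of $X$ is not an automorphism of $\mathbb X$; - $\mathbb X$ is chained by a linear order whose order type is that of a suborder $A$ of $\mathbb R$ containing a nonempty perfect set, i.e. there are a linear order $<$ on $X$ and a set $A\subseteq\mathbb R$ such that $\langle X,<\rangle\cong\langle A,<_{\mathbb R}\rangle$, some nonempty closed $P\subseteq\mathbb R$ without isolated points satisfies $P\subseteq A$, and each isomorphism between suborders of $\langle X,<\rangle$ is an isomorphism between the corresponding substructures of $\mathbb X$. Then there are isomorphisms of Boolean algebras $$\mathbb B_{\mathbb X}\;\cong\;\operatorname{ro}(\mathbb S)\;\cong\;\operatorname{ro}\big(\mathrm{Borel}(\mathbb R)/[\mathbb R]^{\le\omega}\big).$$ Here, for a preorder $\mathbb P$, $\operatorname{ro}(\mathbb P)$ is the Boolean algebra of regular open sets of $\mathbb P$ in the topology generated by the principal ideals $(\cdot,p]=\{q : q\le p\}$, $p\in\mathbb P$; $\operatorname{sq}(\mathbb P)$ is the separative quotient, i.e. the antisymmetric quotient of the preorder $p\le^* q\Leftrightarrow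 \forall r\le p\;\exists s\le r\; s\le q$; $\mathbb P(\mathbb X)=\{f[X] : f \text{ is a self-embedding of } \mathbb X\}$ is ordered by inclusion, and $\mathbb B_{\mathbb X}=\operatorname{ro}(\operatorname{sq}(\mathbb P(\mathbb X)))$; $\mathbb S$ is Sacks forcing, the set of nonempty perfect subsets of $\mathbb R$ ordered by inclusion; $\mathrm{Borel}(\mathbb R)/[\mathbb R]^{\le\omega}$ is the quotient of the algebra of Borel subsets of $\mathbb R$ by the ideal of countable sets, and, as usual, $\operatorname{ro}$ of a Boolean algebra is taken of the poset of its nonzero elements. -/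

import Mathlib

universe u v w

namespace CopyAlgebra

/-! ### Boolean completions of preorders -/

section Completion

/-- The set `P` regarded as a topological space. -/
def IdealSpace (P : Type u) : Type u := P

/-- The topology on a preorder generated by the principal ideals `(·, p]`. -/
instance idealTopology (P : Type u) [Preorder P] : TopologicalSpace (IdealSpace P) :=
  TopologicalSpace.generateFrom (Set.range fun p : P => {q : P | q ≤ p})

/-- `ro P`: the Boolean algebra of regular open subsets of `P`, for the topology generated by the
principal ideals. The pseudocomplement `Uᶜ` in the Heyting algebra of open sets is the interior of
the set complement, so `U` is Heyting-regular, `Uᶜᶜ = U`, if and only if `U` is the interior of its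
closure (see `isRegular_iff_interior_closure`). The order is inclusion. -/
abbrev ro (P : Type u) [Preorder P] : Type u :=
  Heyting.Regular (TopologicalSpace.Opens (IdealSpace P))

/-- Heyting-regular open sets are exactly the regular open sets. -/
theorem isRegular_iff_interior_closure {T : Type u} [TopologicalSpace T]
    (U : TopologicalSpace.Opens T) :
    Heyting.IsRegular U ↔ interior (closure (U : Set T)) = (U : Set T) := by
  have compl_eq : ∀ V : TopologicalSpace.Opens T, ((Vᶜ : TopologicalSpace.Opens T) : Set T)
      = interior ((V : Set T)ᶜ) := by
    intro V
    apply Set.Subset.antisymm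
    · refine interior_maximal ?_ (Vᶜ).isOpen
      intro x hx hxV
      have h : x ∈ ((V ⊓ Vᶜ : TopologicalSpace.Opens T) : Set T) := ⟨hxV, hx⟩
      rw [inf_compl_self] at h
      exact h
    · have h : (⟨interior ((V : Set T)ᶜ), isOpen_interior⟩ : TopologicalSpace.Opens T) ≤ Vᶜ := by
        rw [le_compl_iff_disjoint_right, disjoint_iff_inf_le]
        rintro x ⟨hx, hxV⟩
        exact absurd hxV (interior_subset hx)
      exact h
  unfold Heyting.IsRegular
  rw [← TopologicalSpace.Opens.coe_inj, compl_eq, compl_eq, ← closure_compl, compl_compl]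

/-- The separative modification of `P`: the same set with the preorder
`p ≤* q ↔ ∀ r ≤ p, ∃ s ≤ r, s ≤ q`. -/
def SepMod (P : Type u) : Type u := P

instance sepModPreorder (P : Type u) [Preorder P] : Preorder (SepMod P) where
  le p q := ∀ r : P, @LE.le P _ r p → ∃ s : P, s ≤ r ∧ @LE.le P _ s q
  le_refl _ r hr := ⟨r, le_refl r, hr⟩
  le_trans _ _ _ hpq hqt r hr := by
    obtain ⟨s, hsr, hsq⟩ := hpq r hr
    obtain ⟨z, hzs, hzt⟩ := hqt s hsq
    exact ⟨z, le_trans hzs hsr, hzt⟩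

/-- The separative quotient `sq P`: the antisymmetric quotient of the separative modification. -/
abbrev SepQuot (P : Type u) [Preorder P] : Type u :=
  Antisymmetrization (SepMod P) (· ≤ ·)

end Completion

/-! ### Relational structures -/

section Structures

open FirstOrder FirstOrder.Language

variable (L : FirstOrder.Language.{u, v}) (X : Type w) [L.Structure X]

/-- The poset of copies of `X` inside `X`: the images of the self-embeddings of `X`, ordered by
inclusion. -/
abbrev Copies : Type w := {Y : Set X // ∃ f : X ↪[L] X, Set.range f = Y}

/-- The Boolean completion of the poset of copies of `X`. -/
abbrev CopyCompletion : Type w := ro (SepQuot (Copies L X))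

/-- A bijection `e` between two subsets of `X` is a partial automorphism of the relational
structure `X` if it is an isomorphism between the substructures with domains `S` and `T`. -/
def IsPartialAut {S T : Set X} (e : S ≃ T) : Prop :=
  ∀ (n : ℕ) (R : L.Relations n) (x : Fin n → S),
    Structure.RelMap R (fun i => (x i : X)) ↔ Structure.RelMap R (fun i => (e (x i) : X))

/-- The strict linear order `r` on `X` chains the structure `X`: each isomorphism between
suborders of `⟨X, r⟩` is a partial automorphism of `X`. -/
def IsChainedBy (r : X → X → Prop) : Prop :=
  IsStrictTotalOrder X r ∧
    ∀ (S T : Set X) (e : S ≃ T),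
      (∀ a b : S, r (a : X) (b : X) ↔ r (e a : X) (e b : X)) → IsPartialAut L X e

/-- `X` is chained by a linear order on its domain that is isomorphic to the suborder `A` of the
real line. -/
def IsChainableByReal (A : Set ℝ) : Prop :=
  ∃ r : X → X → Prop, IsChainedBy L X r ∧ Nonempty (r ≃r fun a b : A => a < b)

/-- `X` is constant: each permutation of its domain is an automorphism. -/
def IsConstant : Prop :=
  ∀ e : Equiv.Perm X, ∃ g : X ≃[L] X, g.toEquiv = e

end Structures

/-! ### Sacks forcing and the Borel sets modulo the countable sets -/

section Forcings

/-- Sacks (perfect set) forcing: nonempty perfect subsets of the real line, ordered by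
inclusion. -/
abbrev Sacks : Type := {P : Set ℝ // Perfect P ∧ P.Nonempty}

/-- Two Borel sets of reals are identified if their symmetric difference is countable. -/
def borelSetoid : Setoid {A : Set ℝ // MeasurableSet A} where
  r A B := (symmDiff (A : Set ℝ) (B : Set ℝ)).Countable
  iseqv :=
    { refl := fun A => by simp
      symm := fun {A B} h => by rwa [symmDiff_comm]
      trans := fun {A B C} h₁ h₂ => (h₁.union h₂).mono (symmDiff_triangle _ _ _) }

/-- The quotient algebra of the Borel sets of reals modulo the ideal of countable sets. -/
def BorelModCountable : Type := Quotient borelSetoid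

/-- The order of the quotient algebra: `[A] ≤ [B]` if and only if `A \ B` is countable. -/
instance borelModCountablePartialOrder : PartialOrder BorelModCountable where
  le := Quotient.lift₂ (fun A B => ((A : Set ℝ) \ (B : Set ℝ)).Countable) (by
    have key : ∀ A B A' B' : Set ℝ, (symmDiff A A').Countable → (symmDiff B B').Countable →
        (A \ B).Countable → (A' \ B').Countable := by
      intro A B A' B' hA hB h
      refine ((hA.union hB).union h).mono ?_
      rintro x ⟨hx, hx'⟩
      by_cases h₁ : x ∈ A
      · by_cases h₂ : x ∈ B
        · exact Or.inl (Or.inr (Or.inl ⟨h₂, hx'⟩))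
        · exact Or.inr ⟨h₁, h₂⟩
      · exact Or.inl (Or.inl (Or.inr ⟨hx, h₁⟩))
    intro A B A' B' hA hB
    exact propext ⟨key _ _ _ _ hA hB,
      key _ _ _ _ (borelSetoid.symm hA) (borelSetoid.symm hB)⟩)
  le_refl a := by
    induction a using Quotient.inductionOn with
    | h A => exact (by simp : ((A : Set ℝ) \ (A : Set ℝ)).Countable)
  le_trans a b c := by
    induction a, b using Quotient.inductionOn₂ with
    | h A B =>
      induction c using Quotient.inductionOn with
      | h C =>
        intro h₁ h₂
        refine (Set.Countable.union h₁ h₂).mono ?_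
        rintro x ⟨hx, hx'⟩
        by_cases h : x ∈ (B : Set ℝ)
        · exact Or.inr ⟨h, hx'⟩
        · exact Or.inl ⟨hx, h⟩
  le_antisymm a b := by
    induction a, b using Quotient.inductionOn₂ with
    | h A B => exact fun h₁ h₂ => Quotient.sound (Set.Countable.union h₁ h₂)

/-- The zero of the quotient algebra: the class of the empty set. -/
def BorelModCountable.zero : BorelModCountable :=
  Quotient.mk borelSetoid ⟨∅, MeasurableSet.empty⟩

/-- The positive (nonzero) elements of the quotient algebra. As usual, the Boolean completion of a
Boolean algebra is the completion of the poset of its nonzero elements. -/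
abbrev BorelModCountablePos : Type := {a : BorelModCountable // a ≠ BorelModCountable.zero}

end Forcings

end CopyAlgebra

/-! A dense map of preorders induces an isomorphism of completions (`IsDenseMap.nonempty_ro_iso`),
so all the posets are compared with `Large`, the sets of reals containing a nonempty perfect set,
and with its parts `largeIn A`. Perfect sets are dense in `Large` and, by the perfect set property,
in the Borel sets modulo countable sets.

Identify `X` with `A ⊆ ℝ`. Every large subset of `A` contains a copy of `X`, because the real line
embeds increasingly into each perfect set and increasing maps preserve the relations. Conversely,
copies are large (`hasPerfect_copy`). Otherwise a self-embedding `f` would have uncountably many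
discontinuities, and some rational cut would be jumped at infinitely many two-sided limit points
`w`. A point could then move across such a `w` without changing the order type of the `f`-images;
the relations would be invariant under adjacent transpositions, and `X` would be constant.

So the completion of the copies is that of `largeIn A`. It does not depend on `A`: a perfect subset
of `A` includes an increasing image of `ℝ`, below which the algebra of `Sacks` reappears, and a
Schroeder–Bernstein argument for complete Boolean algebras (`nonempty_iso_Iic`) passes to the larger
factor. -/

namespace CopyAlgebra

/-! ### Regular sets and dense maps -/

section RegularSets

variable {P : Type u} [Preorder P] {Q : Type v} [Preorder Q]

theorem isOpen_idealSpace_iff {s : Set (IdealSpace P)} :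
    IsOpen s ↔ ∀ p q : P, q ≤ p → s p → s q := by
  constructor
  · intro h
    induction h with
    | basic s hs =>
      obtain ⟨r, rfl⟩ := hs
      exact fun p q hqp hp => le_trans hqp hp
    | univ => exact fun _ _ _ _ => trivial
    | inter s t _ _ hs ht => exact fun p q hqp hp => ⟨hs p q hqp hp.1, ht p q hqp hp.2⟩
    | sUnion S _ hS =>
      rintro p q hqp ⟨s, hs, hp⟩
      exact ⟨s, hs, hS s hs p q hqp hp⟩
  · intro h
    have : s = ⋃ p ∈ s, ({q : P | q ≤ p} : Set P) := by
      ext q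
      refine Iff.trans ?_ Set.mem_iUnion₂.symm
      exact ⟨fun hq => ⟨q, hq, le_refl (α := P) q⟩, fun ⟨p, hp, hqp⟩ => h p q hqp hp⟩
    rw [this]
    exact isOpen_biUnion (X := IdealSpace P) (s := s) (f := fun p => {q : P | q ≤ p})
      fun p _ => TopologicalSpace.GenerateOpen.basic _ ⟨p, rfl⟩

theorem mem_interior_idealSpace {s : Set (IdealSpace P)} (p : P) :
    interior s p ↔ ∀ q : P, q ≤ p → s q := by
  constructor
  · intro h q hq
    exact interior_subset (X := IdealSpace P) (isOpen_idealSpace_iff.1 (isOpen_interior (s := s)) p q hq h)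
  · intro h
    have hs : {q : P | q ≤ p} ⊆ s := h
    exact interior_maximal (X := IdealSpace P) hs
      (TopologicalSpace.GenerateOpen.basic _ ⟨p, rfl⟩) (le_refl (α := P) p)

theorem mem_closure_idealSpace {s : Set (IdealSpace P)} (p : P) :
    closure s p ↔ ∃ q : P, q ≤ p ∧ s q := by
  rw [closure_eq_compl_interior_compl]
  change ¬ interior sᶜ p ↔ _
  rw [mem_interior_idealSpace]
  push Not
  exact exists_congr fun q => and_congr Iff.rfl not_not

/-- The combinatorial form of regularity for a subset of a preorder. -/
def IsRegularSet (U : Set P) : Prop :=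
  ∀ p, p ∈ U ↔ ∀ q ≤ p, ∃ r ≤ q, r ∈ U

theorem IsRegularSet.lower {U : Set P} (hU : IsRegularSet U) {p q : P} (hqp : q ≤ p)
    (hp : p ∈ U) : q ∈ U :=
  (hU q).2 fun r hr => (hU p).1 hp r (hr.trans hqp)

variable (P) in
/-- The regular subsets of a preorder, ordered by inclusion. -/
abbrev RegSets : Type u := {U : Set P // IsRegularSet U}

theorem interior_closure_eq_iff {U : Set (IdealSpace P)} :
    interior (closure U) = U ↔ IsRegularSet (P := P) U := by
  have key (p : P) : interior (closure U) p ↔ ∀ q ≤ p, ∃ r ≤ q, U r := by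
    rw [mem_interior_idealSpace]
    exact forall₂_congr fun q _ => mem_closure_idealSpace q
  constructor
  · intro h p
    refine Iff.trans ?_ (key p)
    rw [h]
    rfl
  · intro h
    ext p
    exact (key p).trans (h p).symm

variable (P) in
/-- The completion of a preorder consists of its regular subsets. -/
def roEquivRegSets : ro P ≃o RegSets P where
  toFun U := ⟨((U : TopologicalSpace.Opens (IdealSpace P)) : Set (IdealSpace P)),
    interior_closure_eq_iff.1 ((isRegular_iff_interior_closure _).1 U.2)⟩
  invFun U := ⟨⟨U.1, isOpen_idealSpace_iff.2 fun _ _ hqp hp => U.2.lower hqp hp⟩,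
    (isRegular_iff_interior_closure _).2 (interior_closure_eq_iff.2 U.2)⟩
  left_inv _ := rfl
  right_inv _ := rfl
  map_rel_iff' := Iff.rfl

/-- A dense map of preorders: monotone, reflecting compatibility, and with dense range. -/
structure IsDenseMap (f : P → Q) : Prop where
  mono : ∀ p p', p ≤ p' → f p ≤ f p'
  compat : ∀ p p' q, q ≤ f p → q ≤ f p' → ∃ r, r ≤ p ∧ r ≤ p'
  dense : ∀ q, ∃ p, f p ≤ q

theorem IsDenseMap.isRegularSet_preimage {f : P → Q} (hf : IsDenseMap f) {V : Set Q}
    (hV : IsRegularSet V) : IsRegularSet (f ⁻¹' V) := by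
  intro p
  constructor
  · exact fun hp q hq => ⟨q, le_rfl, hV.lower (hf.mono _ _ hq) hp⟩
  · intro h
    refine (hV _).2 fun q hq => ?_
    obtain ⟨p', hp'⟩ := hf.dense q
    obtain ⟨r, hrp, hrp'⟩ := hf.compat p p' (f p') (hp'.trans hq) le_rfl
    obtain ⟨s, hsr, hs⟩ := h r hrp
    exact ⟨f s, (hf.mono _ _ (hsr.trans hrp')).trans hp', hs⟩

theorem IsDenseMap.mem_iff {f : P → Q} (hf : IsDenseMap f) {V : Set Q} (hV : IsRegularSet V)
    (q : Q) : q ∈ V ↔ ∀ p, f p ≤ q → f p ∈ V := by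
  refine ⟨fun hq p hp => hV.lower hp hq, fun h => (hV q).2 fun r hr => ?_⟩
  obtain ⟨p, hp⟩ := hf.dense r
  exact ⟨f p, hp, h p (hp.trans hr)⟩

/-- By `IsDenseMap.mem_iff` a regular set is determined by its trace on the range of `f`, which
leaves a single candidate for `V`; reflection of compatibility makes it regular. -/
theorem IsDenseMap.exists_preimage {f : P → Q} (hf : IsDenseMap f) {U : Set P}
    (hU : IsRegularSet U) : ∃ V : Set Q, IsRegularSet V ∧ f ⁻¹' V = U := by
  refine ⟨{q | ∀ p, f p ≤ q → p ∈ U}, fun q => ⟨?_, ?_⟩, ?_⟩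
  · exact fun hq r hr => ⟨r, le_rfl, fun p hp => hq p (hp.trans hr)⟩
  · intro h p hp
    refine (hU p).2 fun p' hp' => ?_
    obtain ⟨r, hr, hrU⟩ := h (f p') ((hf.mono _ _ hp').trans hp)
    obtain ⟨s, hs⟩ := hf.dense r
    obtain ⟨t, htp', hts⟩ := hf.compat p' s (f s) (hs.trans hr) le_rfl
    exact ⟨t, htp', hU.lower hts (hrU s hs)⟩
  · ext p
    refine ⟨fun h => h p le_rfl, fun hp p' hp' => (hU p').2 fun r hr => ?_⟩
    obtain ⟨s, hsr, hsp⟩ := hf.compat r p (f r) le_rfl ((hf.mono _ _ hr).trans hp')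
    exact ⟨s, hsr, hU.lower hsp hp⟩

theorem IsDenseMap.nonempty_regSets_iso {f : P → Q} (hf : IsDenseMap f) :
    Nonempty (RegSets Q ≃o RegSets P) := by
  refine ⟨RelIso.ofSurjective (OrderEmbedding.ofMapLEIff
    (fun V : RegSets Q => (⟨f ⁻¹' V.1, hf.isRegularSet_preimage V.2⟩ : RegSets P)) ?_) ?_⟩
  · intro V V'
    refine ⟨fun h q hq => ?_, fun h p hp => h hp⟩
    exact (hf.mem_iff V'.2 q).2 fun p hp => h ((hf.mem_iff V.2 q).1 hq p hp)
  · rintro ⟨U, hU⟩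
    obtain ⟨V, hV, h⟩ := hf.exists_preimage hU
    exact ⟨⟨V, hV⟩, Subtype.ext h⟩

/-- A dense map induces an isomorphism of completions. -/
theorem IsDenseMap.nonempty_ro_iso {f : P → Q} (hf : IsDenseMap f) :
    Nonempty (ro P ≃o ro Q) :=
  hf.nonempty_regSets_iso.map fun e =>
    (roEquivRegSets P).trans (e.symm.trans (roEquivRegSets Q).symm)

variable (P) in
theorem isDenseMap_sepQuot :
    IsDenseMap fun p : P => (toAntisymmetrization (· ≤ ·) (show SepMod P from p) : SepQuot P) where
  mono p p' h := by
    rw [toAntisymmetrization_le_toAntisymmetrization_iff]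
    exact fun r hr => ⟨r, le_rfl, le_trans hr h⟩
  compat p p' q hp hp' := by
    induction q using Antisymmetrization.ind with
    | _ q =>
    rw [toAntisymmetrization_le_toAntisymmetrization_iff] at hp hp'
    obtain ⟨s, hsq, hsp⟩ := hp q (le_refl (α := P) q)
    obtain ⟨t, hts, htp'⟩ := hp' s hsq
    exact ⟨t, le_trans hts hsp, htp'⟩
  dense q := by
    induction q using Antisymmetrization.ind with
    | _ q => exact ⟨q, le_rfl⟩

end RegularSets

/-! ### Factors of complete Boolean algebras -/

section SchroederBernstein

theorem exists_isGLB_ro {P : Type u} [Preorder P] (s : Set (ro P)) : ∃ m, IsGLB s m := by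
  let m : RegSets P := ⟨{p | ∀ U ∈ s, p ∈ (roEquivRegSets P U).1}, fun p =>
    ⟨fun h q hq => ⟨q, le_rfl, fun U hU => (roEquivRegSets P U).2.lower hq (h U hU)⟩,
      fun h U hU => ((roEquivRegSets P U).2 p).2 fun q hq =>
        (h q hq).imp fun r hr => ⟨hr.1, hr.2 U hU⟩⟩⟩
  refine ⟨(roEquivRegSets P).symm m, fun U hU p hp => hp U hU, fun V hV p hp U hU => ?_⟩
  exact (show V ≤ U from hV hU) hp

/-- If a complete Boolean algebra `B` is isomorphic to its factor below `a` and `a ≤ b`, then it is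
isomorphic to its factor below `b`. -/
theorem nonempty_iso_Iic {B : Type u} [BooleanAlgebra B] (hB : ∀ s : Set B, ∃ m, IsGLB s m)
    {a b : B} (hab : a ≤ b) (θ : B ≃o Set.Iic a) : Nonempty (B ≃o Set.Iic b) := by
  have hθ {x y : B} : (θ x : B) ≤ θ y ↔ x ≤ y := θ.le_iff_le
  -- Knaster–Tarski: `m` is the least fixed point of `x ↦ bᶜ ⊔ θ x`. Then `θ` carries the part below
  -- `m` onto the part below `θ m = b ⊓ m`, and the isomorphism glues it with the identity below `mᶜ
  -- ≤ b`.
  obtain ⟨m, hm⟩ := hB {x | bᶜ ⊔ θ x ≤ x}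
  have hm1 : bᶜ ⊔ θ m ≤ m := hm.2 fun x hx =>
    (sup_le_sup_left (hθ.2 (hm.1 hx)) _).trans hx
  have hm2 : m ≤ bᶜ ⊔ θ m := hm.1 (sup_le_sup_left (hθ.2 hm1) _)
  have hθm : (θ m : B) ≤ m := le_sup_right.trans hm1
  have hmb : mᶜ ≤ b := compl_le_iff_compl_le.1 (le_sup_left.trans hm1)
  have hbm : b ⊓ m ≤ θ m := by
    refine (inf_le_inf_left b hm2).trans ?_
    rw [inf_sup_left, inf_compl_self, bot_sup_eq]
    exact inf_le_right
  have hdis {x y : B} (h : x ≤ m) : (x ⊔ y ⊓ mᶜ) ⊓ m = x := by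
    rw [inf_sup_right, inf_assoc, compl_inf_self, inf_bot_eq, sup_bot_eq, inf_eq_left.2 h]
  have hdis' {x y : B} (h : x ≤ m) : (x ⊔ y ⊓ mᶜ) ⊓ mᶜ = y ⊓ mᶜ := by
    rw [inf_sup_right, inf_assoc, inf_idem, (disjoint_compl_right.mono_left h).eq_bot,
      bot_sup_eq]
  have hle (x : B) : (θ (x ⊓ m) : B) ≤ m := (hθ.2 inf_le_right).trans hθm
  refine ⟨RelIso.ofSurjective (OrderEmbedding.ofMapLEIff (fun x : B =>
    (⟨θ (x ⊓ m) ⊔ x ⊓ mᶜ, sup_le ((θ _).2.trans hab) (inf_le_right.trans hmb)⟩ : Set.Iic b))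
      ?_) ?_⟩
  · intro x y
    change (θ (x ⊓ m) : B) ⊔ x ⊓ mᶜ ≤ (θ (y ⊓ m) : B) ⊔ y ⊓ mᶜ ↔ x ≤ y
    constructor
    · intro h
      have h1 := inf_le_inf_right m h
      have h2 := inf_le_inf_right mᶜ h
      rw [hdis (hle _), hdis (hle _), hθ] at h1
      rw [hdis' (hle _), hdis' (hle _)] at h2
      calc x = x ⊓ m ⊔ x ⊓ mᶜ := by rw [← inf_sup_left, sup_compl_eq_top, inf_top_eq]
        _ ≤ y := sup_le (h1.trans inf_le_left) (h2.trans inf_le_left)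
    · exact fun h => sup_le_sup (hθ.2 (inf_le_inf_right m h)) (inf_le_inf_right _ h)
  · rintro ⟨y, hy : y ≤ b⟩
    have hya : y ⊓ m ≤ a := ((inf_le_inf_right m hy).trans hbm).trans (θ m).2
    set z : B := θ.symm ⟨y ⊓ m, hya⟩ with hz
    have hθz : (θ z : B) = y ⊓ m := by simp [hz]
    have hzm : z ≤ m := by
      rw [← hθ, hθz]
      exact (inf_le_inf_right m hy).trans hbm
    refine ⟨z ⊔ y ⊓ mᶜ, Subtype.ext ?_⟩
    change (θ ((z ⊔ y ⊓ mᶜ) ⊓ m) : B) ⊔ (z ⊔ y ⊓ mᶜ) ⊓ mᶜ = y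
    rw [hdis hzm, hdis' hzm, hθz, ← inf_sup_left, sup_compl_eq_top, inf_top_eq]

/-- The completion of a downward closed part of a preorder is a factor of the completion. -/
theorem exists_iso_Iic_of_lower {P : Type u} [Preorder P] {D : Set P}
    (hD : ∀ p ∈ D, ∀ q ≤ p, q ∈ D) :
    ∃ d : ro P, Nonempty (ro D ≃o Set.Iic d) ∧
      (roEquivRegSets P d).1 = {p | ∀ q ≤ p, ∃ r ≤ q, r ∈ D} := by
  have hclos {U : Set P} (hU : ∀ p ∈ U, ∀ q ≤ p, q ∈ U) :
      IsRegularSet {p | ∀ q ≤ p, ∃ r ≤ q, r ∈ U} := by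
    refine fun p => ⟨fun h q hq => ?_, fun h q hq => ?_⟩
    · exact ⟨q, le_rfl, fun r hr => h r (hr.trans hq)⟩
    · obtain ⟨r, hr, h'⟩ := h q hq
      obtain ⟨s, hs, hsU⟩ := h' r le_rfl
      exact ⟨s, hs.trans hr, hsU⟩
  -- `d` is the regularization of `D`, in which `D` is dense; a regular set below `d` is therefore
  -- determined by its trace on `D`.
  let d : RegSets P := ⟨_, hclos hD⟩
  have e : Nonempty (Set.Iic d ≃o RegSets D) := by
    refine ⟨RelIso.ofSurjective (OrderEmbedding.ofMapLEIff (fun V : Set.Iic d =>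
      (⟨Subtype.val ⁻¹' V.1.1, ?_⟩ : RegSets D)) ?_) ?_⟩
    · rintro ⟨p, hp⟩
      refine (V.1.2 p).trans ⟨fun h q hq => ?_, fun h q hq => ?_⟩
      · obtain ⟨r, hr, hrV⟩ := h q hq
        exact ⟨⟨r, hD _ q.2 _ hr⟩, hr, hrV⟩
      · obtain ⟨r, hr, hrV⟩ := h ⟨q, hD _ hp _ hq⟩ hq
        exact ⟨r, hr, hrV⟩
    · rintro ⟨V, hV⟩ ⟨V', hV'⟩
      refine ⟨fun h p hp => (V'.2 p).2 fun q hq => ?_, fun h p hp => h hp⟩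
      obtain ⟨r, hr, hrD⟩ := hV hp q hq
      exact ⟨r, hr, @h ⟨r, hrD⟩ (V.2.lower (hr.trans hq) hp)⟩
    · rintro ⟨U, hU⟩
      have hlow : ∀ p ∈ Subtype.val '' U, ∀ q ≤ p, q ∈ Subtype.val '' U := by
        rintro _ ⟨p, hp, rfl⟩ q hq
        exact ⟨⟨q, hD _ p.2 _ hq⟩, hU.lower hq hp, rfl⟩
      refine ⟨⟨⟨_, hclos hlow⟩, fun p hp q hq => ?_⟩, Subtype.ext ?_⟩
      · obtain ⟨_, hr, r, -, rfl⟩ := hp q hq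
        exact ⟨r, hr, r.2⟩
      · ext p
        refine Iff.trans ⟨fun h q hq => ?_, fun h q hq => ?_⟩ (hU p).symm
        · obtain ⟨_, hr, r, hrU, rfl⟩ := h q hq
          exact ⟨r, hr, hrU⟩
        · obtain ⟨r, hr, hrU⟩ := h ⟨q, hD _ p.2 _ hq⟩ hq
          exact ⟨r, hr, r, hrU, rfl⟩
  obtain ⟨e⟩ := e
  refine ⟨(roEquivRegSets P).symm d, ⟨(roEquivRegSets D).trans (e.symm.trans ?_)⟩, rfl⟩
  exact
    { toFun := fun V => ⟨(roEquivRegSets P).symm V, (roEquivRegSets P).symm.monotone V.2⟩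
      invFun := fun V => ⟨roEquivRegSets P V, V.2⟩
      left_inv := fun _ => rfl
      right_inv := fun _ => rfl
      map_rel_iff' := Iff.rfl }

/-- If the completion of `P` is isomorphic to that of a lower subset of `P`, then it is isomorphic
to that of every larger lower subset. -/
theorem nonempty_ro_iso_of_lower {P : Type u} [Preorder P] {D E : Set P}
    (hD : ∀ p ∈ D, ∀ q ≤ p, q ∈ D) (hE : ∀ p ∈ E, ∀ q ≤ p, q ∈ E) (hDE : D ⊆ E)
    (e : Nonempty (ro P ≃o ro D)) : Nonempty (ro P ≃o ro E) := by
  obtain ⟨e⟩ := e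
  obtain ⟨a, ⟨ea⟩, ha⟩ := exists_iso_Iic_of_lower hD
  obtain ⟨b, ⟨eb⟩, hb⟩ := exists_iso_Iic_of_lower hE
  have hab : a ≤ b := by
    rw [← (roEquivRegSets P).le_iff_le, ← Subtype.coe_le_coe, ha, hb]
    exact fun p hp q hq => (hp q hq).imp fun r hr => ⟨hr.1, hDE hr.2⟩
  obtain ⟨f⟩ := nonempty_iso_Iic exists_isGLB_ro hab (e.trans ea)
  exact ⟨f.trans eb.symm⟩

end SchroederBernstein

/-! ### Perfect sets of reals and increasing maps -/

section PerfectSets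

open Set Filter Topology

/-- A set of reals contains a nonempty perfect set. -/
def HasPerfect (S : Set ℝ) : Prop := ∃ Q : Set ℝ, Perfect Q ∧ Q.Nonempty ∧ Q ⊆ S

theorem HasPerfect.mono {S T : Set ℝ} (hS : HasPerfect S) (h : S ⊆ T) : HasPerfect T :=
  let ⟨Q, hQ, hne, hQS⟩ := hS
  ⟨Q, hQ, hne, hQS.trans h⟩

theorem not_countable_range_cantor {α : Type u} {c : (ℕ → Bool) → α} (hc : Function.Injective c) :
    ¬ (range c).Countable := by
  have h2 : Cardinal.mk (ℕ → Bool) = Cardinal.continuum := by simp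
  intro h
  have : Countable (ℕ → Bool) := by
    rw [← image_univ] at h
    exact countable_univ_iff.1 (countable_of_injective_of_countable_image hc.injOn h)
  refine absurd (Cardinal.mk_le_aleph0_iff.2 this) (not_le.2 ?_)
  exact h2 ▸ Cardinal.aleph0_lt_continuum

theorem hasPerfect_of_cantor {S : Set ℝ} {c : (ℕ → Bool) → ℝ} (hc : Continuous c)
    (hinj : Function.Injective c) (hcS : range c ⊆ S) : HasPerfect S := by
  -- The perfect kernel of the compact uncountable range suffices.
  obtain ⟨D, hD, hne, hDc⟩ := exists_perfect_nonempty_of_isClosed_of_not_countable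
    (isCompact_range hc).isClosed (not_countable_range_cantor hinj)
  exact ⟨D, hD, hne, hDc.trans hcS⟩

/-- A finer Polish topology makes `B` closed; a Cantor set found there remains continuous for the
coarser usual topology. -/
theorem _root_.MeasurableSet.exists_cantor_of_not_countable {B : Set ℝ} (hB : MeasurableSet B)
    (hunc : ¬ B.Countable) :
    ∃ c : (ℕ → Bool) → ℝ, Continuous c ∧ Function.Injective c ∧ range c ⊆ B := by
  obtain ⟨t', ht', hpol, hcl, -⟩ := hB.isClopenable
  obtain ⟨c, hcB, hc, hinj⟩ :=
    @IsClosed.exists_nat_bool_injection_of_not_countable ℝ t' hpol B hcl hunc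
  exact ⟨c, continuous_le_rng ht' hc, hinj, hcB⟩

/-- The perfect set property of Borel sets. -/
theorem hasPerfect_of_measurableSet {B : Set ℝ} (hB : MeasurableSet B) (hunc : ¬ B.Countable) :
    HasPerfect B :=
  let ⟨_, hc, hinj, hcB⟩ := hB.exists_cantor_of_not_countable hunc
  hasPerfect_of_cantor hc hinj hcB

theorem HasPerfect.not_countable {S : Set ℝ} (hS : HasPerfect S) : ¬ S.Countable := by
  obtain ⟨Q, hQ, hne, hQS⟩ := hS
  obtain ⟨c, hcQ, -, hinj⟩ := hQ.exists_nat_bool_injection hne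
  exact fun h => not_countable_range_cantor hinj (h.mono (hcQ.trans hQS))

/-- The image of a set containing a perfect set under an injection with countably many
discontinuities contains a perfect set. -/
theorem HasPerfect.image {T Z : Set ℝ} {F : ℝ → ℝ} (hT : HasPerfect T) (hF : InjOn F T)
    (hZ : Z.Countable) (hcont : ∀ x ∈ T, x ∉ Z → ContinuousWithinAt F T x) :
    HasPerfect (F '' T) := by
  obtain ⟨Q, hQ, hne, hQT⟩ := hT
  -- `T` need not be Borel, but `Q \ Z` is, and it contains a Cantor set on which `F` is continuous.
  have hunc : ¬ (Q \ Z).Countable := fun h =>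
    HasPerfect.not_countable ⟨Q, hQ, hne, Subset.rfl⟩
      ((h.union hZ).mono (by rw [sdiff_union_self]; exact subset_union_left))
  obtain ⟨c, hc, hinj, hcQ⟩ :=
    (hQ.closed.measurableSet.diff hZ.measurableSet).exists_cantor_of_not_countable hunc
  have hcT (y) : c y ∈ T := hQT (hcQ ⟨y, rfl⟩).1
  refine hasPerfect_of_cantor (c := F ∘ c) ?_ (fun x y h => hinj (hF (hcT x) (hcT y) h)) ?_
  · rw [continuous_iff_continuousAt]
    intro y
    exact (hcont _ (hcT y) (hcQ ⟨y, rfl⟩).2).tendsto.comp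
      (tendsto_nhdsWithin_iff.2 ⟨hc.continuousAt, Eventually.of_forall hcT⟩)
  · rintro _ ⟨y, rfl⟩
    exact ⟨c y, hcT y, rfl⟩

theorem HasPerfect.image_strictMono {S : Set ℝ} (hS : HasPerfect S) {g : ℝ → ℝ}
    (hg : StrictMono g) : HasPerfect (g '' S) :=
  hS.image hg.injective.injOn hg.monotone.countable_not_continuousAt fun _ _ hx =>
    (not_not.1 hx).continuousWithinAt

/-- For `Q ⊆ T` perfect, `g ⁻¹' Q` is Borel since monotone maps are measurable, and uncountable
since its image is `Q`. -/
theorem HasPerfect.of_subset_image_strictMono {S T : Set ℝ} (hT : HasPerfect T) {g : ℝ → ℝ}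
    (hg : StrictMono g) (h : T ⊆ g '' S) : HasPerfect S := by
  obtain ⟨Q, hQ, hne, hQT⟩ := hT
  have himg : g '' (g ⁻¹' Q) = Q :=
    image_preimage_eq_of_subset ((hQT.trans h).trans (image_subset_range _ _))
  refine (hasPerfect_of_measurableSet (hg.monotone.measurable hQ.closed.measurableSet)
    fun hc => ?_).mono (S := g ⁻¹' Q) ?_
  · exact HasPerfect.not_countable ⟨Q, hQ, hne, Subset.rfl⟩ (himg ▸ hc.image g)
  · intro x hx
    obtain ⟨y, hy, hyx⟩ := h (hQT hx)
    exact hg.injective hyx ▸ hy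

/-- The points of `T` that are not limits of points of `T` from both sides form a countable set. -/
theorem countable_not_two_sided (T : Set ℝ) :
    {x ∈ closure T | ¬ ((∃ᶠ y in 𝓝[<] x, y ∈ T) ∧ ∃ᶠ y in 𝓝[>] x, y ∈ T)}.Countable := by
  refine ((countable_setOfPred_isolated_left_within (s := closure T)).union
    (countable_setOfPred_isolated_right_within (s := closure T))).mono ?_
  rintro x ⟨hxT, hx⟩
  -- Half-lines are open, so a one-sided limit of `closure T` is one of `T`. The exceptional points
  -- are thus isolated on one side in `closure T`.
  have key {s : Set ℝ} (hs : IsOpen s) (h : ¬ ∃ᶠ y in 𝓝[s] x, y ∈ T) :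
      𝓝[closure T ∩ s] x = ⊥ := by
    rw [frequently_nhdsWithin_iff] at h
    exact notMem_closure_iff_nhdsWithin_eq_bot.1 fun hx => h (mem_closure_iff_frequently.1
      (closure_minimal hs.closure_inter isClosed_closure hx))
  rcases not_and_or.1 hx with h | h
  · exact Or.inl ⟨hxT, key isOpen_Iio h⟩
  · exact Or.inr ⟨hxT, key isOpen_Ioi h⟩

/-- The real line embeds into every nonempty perfect set of reals. -/
theorem exists_strictMono_of_perfect {Q : Set ℝ} (hQ : Perfect Q) (hne : Q.Nonempty) :
    ∃ g : ℝ → ℝ, StrictMono g ∧ ∀ x, g x ∈ Q := by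
  let D : Set ℝ := {x ∈ Q | (∃ᶠ y in 𝓝[<] x, y ∈ Q) ∧ ∃ᶠ y in 𝓝[>] x, y ∈ Q}
  have hDc : (Q \ D).Countable := by
    refine (countable_not_two_sided Q).mono ?_
    rintro x ⟨hx, hxD⟩
    exact ⟨subset_closure hx, fun h => hxD ⟨hx, h⟩⟩
  have hmeet {x y z : ℝ} (hz : z ∈ Q) (hxz : x < z) (hzy : z < y) : ∃ d ∈ D, x < d ∧ d < y := by
    by_contra! hno
    -- The closure of `Ioo x y ∩ Q` is perfect, hence uncountable, while without points of `D` in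
    -- the interval it lies in `Q \ D` together with the two endpoints.
    obtain ⟨hp, hpne⟩ := hQ.closure_nhds_inter z hz (U := Ioo x y) ⟨hxz, hzy⟩ isOpen_Ioo
    refine HasPerfect.not_countable ⟨_, hp, hpne, Subset.rfl⟩
      ((hDc.union ((countable_singleton y).insert x)).mono ?_)
    intro w hw
    have hwQ : w ∈ Q := hQ.closed.closure_subset_iff.2 inter_subset_right hw
    have hwI : w ∈ Icc x y :=
      isClosed_Icc.closure_subset_iff.2 (inter_subset_left.trans Ioo_subset_Icc_self) hw
    rcases eq_or_lt_of_le hwI.1 with h | h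
    · exact Or.inr (Or.inl h.symm)
    rcases eq_or_lt_of_le hwI.2 with h' | h'
    · exact Or.inr (Or.inr h')
    · exact Or.inl ⟨hwQ, fun hwD => (hno w hwD h).not_gt h'⟩
  have hdense : DenselyOrdered D := ⟨fun x y hxy => by
    obtain ⟨z, hzQ, hz⟩ := (x.2.2.2.and_eventually (Ioo_mem_nhdsGT hxy)).exists
    obtain ⟨d, hd, h1, h2⟩ := hmeet hzQ hz.1 hz.2
    exact ⟨⟨d, hd⟩, h1, h2⟩⟩
  have hnt : Nontrivial D := by
    obtain ⟨z, hz⟩ := hne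
    obtain ⟨d, hd, -, -⟩ := hmeet hz (sub_one_lt z) (lt_add_one z)
    obtain ⟨z', hzQ', hz'⟩ := (hd.2.2.and_eventually self_mem_nhdsWithin).exists
    obtain ⟨d', hd', h, -⟩ := hmeet hzQ' hz' (lt_add_one z')
    exact ⟨⟨d, hd⟩, ⟨d', hd'⟩, fun he => h.ne (congrArg Subtype.val he)⟩
  -- Only `ℚ` is embedded into `D`; the extension to `ℝ` by suprema may leave `D` but stays in the
  -- closed set `Q`.
  obtain ⟨i⟩ := Order.embedding_from_countable_to_dense ℚ D
  have hi {p q : ℚ} : (i p : ℝ) < i q ↔ p < q := i.lt_iff_lt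
  let I : ℝ → Set ℝ := fun r => (fun q : ℚ => (i q : ℝ)) '' {q : ℚ | (q : ℝ) < r}
  have hIub {r : ℝ} {q : ℚ} (h : r ≤ q) : (i q : ℝ) ∈ upperBounds (I r) := by
    rintro _ ⟨p, hp, rfl⟩
    exact (hi.2 (Rat.cast_lt.1 (lt_of_lt_of_le hp h))).le
  have hIne (r : ℝ) : (I r).Nonempty :=
    let ⟨q, hq⟩ := exists_rat_lt r
    ⟨_, q, hq, rfl⟩
  have hIbdd (r : ℝ) : BddAbove (I r) :=
    let ⟨_, hq⟩ := exists_rat_gt r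
    ⟨_, hIub hq.le⟩
  refine ⟨fun r => sSup (I r), fun r s hrs => ?_, fun r => ?_⟩
  · obtain ⟨p, hrp, hps⟩ := exists_rat_btwn hrs
    obtain ⟨q, hpq, hqs⟩ := exists_rat_btwn hps
    calc sSup (I r) ≤ i p := csSup_le (hIne r) (hIub hrp.le)
      _ < i q := hi.2 (Rat.cast_lt.1 hpq)
      _ ≤ sSup (I s) := le_csSup (hIbdd s) ⟨q, hqs, rfl⟩
  · refine closure_minimal ?_ hQ.closed (csSup_mem_closure (hIne r) (hIbdd r))
    rintro _ ⟨q, -, rfl⟩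
    exact (i q).2.1

end PerfectSets

/-! ### Large sets, Sacks forcing and Borel sets modulo countable sets -/

section Completions

open Set

/-- The sets of reals containing a nonempty perfect set, ordered by inclusion. -/
abbrev Large : Type := {S : Set ℝ // HasPerfect S}

/-- The elements of `Large` that are contained in `A`. -/
abbrev largeIn (A : Set ℝ) : Set Large := {S | S.1 ⊆ A}

theorem lower_largeIn (A : Set ℝ) : ∀ S ∈ largeIn A, ∀ T ≤ S, T ∈ largeIn A :=
  fun _ hS _ hT => Subset.trans hT hS

theorem isDenseMap_sacks_large :
    IsDenseMap fun Q : Sacks => (⟨Q.1, Q.1, Q.2.1, Q.2.2, Subset.rfl⟩ : Large) where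
  mono _ _ h := h
  compat := by
    rintro p p' ⟨S, Q, hQ, hne, hQS⟩ hp hp'
    exact ⟨⟨Q, hQ, hne⟩, hQS.trans hp, hQS.trans hp'⟩
  dense := by
    rintro ⟨S, Q, hQ, hne, hQS⟩
    exact ⟨⟨Q, hQ, hne⟩, hQS⟩

theorem isDenseMap_sacks_range {g : ℝ → ℝ} (hg : StrictMono g) :
    IsDenseMap fun Q : Sacks =>
      (⟨⟨g '' Q.1, HasPerfect.image_strictMono ⟨Q.1, Q.2.1, Q.2.2, Subset.rfl⟩ hg⟩,
        image_subset_range _ _⟩ : largeIn (range g)) where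
  mono _ _ h := image_mono h
  compat := by
    rintro p p' ⟨⟨S, hS⟩, hSg⟩ hp hp'
    obtain ⟨Q, hQ, hne, hQS⟩ := hS.of_subset_image_strictMono (S := p.1 ∩ p'.1) hg (by
      rw [image_inter hg.injective]
      exact subset_inter hp hp')
    exact ⟨⟨Q, hQ, hne⟩, hQS.trans inter_subset_left, hQS.trans inter_subset_right⟩
  dense := by
    rintro ⟨⟨S, hS⟩, hSg⟩
    obtain ⟨Q, hQ, hne, hQS⟩ := hS.of_subset_image_strictMono (S := g ⁻¹' S) hg
      (image_preimage_eq_of_subset hSg).superset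
    exact ⟨⟨Q, hQ, hne⟩, image_subset_iff.2 hQS⟩

/-- Since `range g ⊆ Q ⊆ A`, the factor given by `A` lies between the whole algebra and a factor
isomorphic to it. -/
theorem nonempty_ro_sacks_iso_largeIn {A : Set ℝ} (hA : HasPerfect A) :
    Nonempty (ro Sacks ≃o ro (largeIn A)) := by
  obtain ⟨Q, hQ, hne, hQA⟩ := hA
  obtain ⟨g, hg, hgQ⟩ := exists_strictMono_of_perfect hQ hne
  obtain ⟨e⟩ := isDenseMap_sacks_large.nonempty_ro_iso
  obtain ⟨e'⟩ := (isDenseMap_sacks_range hg).nonempty_ro_iso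
  obtain ⟨e''⟩ := nonempty_ro_iso_of_lower (lower_largeIn (range g)) (lower_largeIn A)
    (fun S hS => Subset.trans hS ((range_subset_iff.2 hgQ).trans hQA)) ⟨e.symm.trans e'⟩
  exact ⟨e.trans e''⟩

theorem BorelModCountable.mk_ne_zero_iff {B : {A : Set ℝ // MeasurableSet A}} :
    (Quotient.mk borelSetoid B : BorelModCountable) ≠ BorelModCountable.zero ↔
      ¬ B.1.Countable := by
  refine not_congr (Quotient.eq.trans ?_)
  change (symmDiff B.1 ∅).Countable ↔ _
  rw [← bot_eq_empty, symmDiff_bot]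

theorem isDenseMap_sacks_borel :
    IsDenseMap fun Q : Sacks =>
      (⟨Quotient.mk borelSetoid ⟨Q.1, Q.2.1.closed.measurableSet⟩,
        BorelModCountable.mk_ne_zero_iff.2
          (HasPerfect.not_countable ⟨Q.1, Q.2.1, Q.2.2, Subset.rfl⟩)⟩ : BorelModCountablePos) where
  mono Q Q' h := by
    change (Q.1 \ Q'.1).Countable
    rw [sdiff_eq_empty.2 h]
    exact countable_empty
  compat := by
    rintro p p' ⟨b, hb⟩ hp hp'
    induction b using Quotient.inductionOn with
    | h B =>
    change (B.1 \ p.1).Countable at hp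
    change (B.1 \ p'.1).Countable at hp'
    replace hb := BorelModCountable.mk_ne_zero_iff.1 hb
    -- Up to a countable set `B` lies in both perfect sets, so their intersection is uncountable.
    obtain ⟨Q, hQ, hne, hQB⟩ := hasPerfect_of_measurableSet
      (p.2.1.closed.measurableSet.inter p'.2.1.closed.measurableSet) fun hc =>
        hb (((hp.union hp').union hc).mono fun x hx => by
          by_cases h : x ∈ p.1 <;> by_cases h' : x ∈ p'.1 <;> simp [hx, h, h'])
    exact ⟨⟨Q, hQ, hne⟩, hQB.trans inter_subset_left, hQB.trans inter_subset_right⟩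
  dense := by
    rintro ⟨b, hb⟩
    induction b using Quotient.inductionOn with
    | h B =>
    obtain ⟨Q, hQ, hne, hQB⟩ :=
      hasPerfect_of_measurableSet B.2 (BorelModCountable.mk_ne_zero_iff.1 hb)
    refine ⟨⟨Q, hQ, hne⟩, ?_⟩
    change (Q \ B.1).Countable
    rw [sdiff_eq_empty.2 hQB]
    exact countable_empty

end Completions

/-! ### Chained structures and their self-embeddings -/

section Chains

open Set Filter Topology FirstOrder FirstOrder.Language

variable {L : FirstOrder.Language.{u, v}} {X : Type w} [L.Structure X]

/-- `φ` identifies `X` with a set of reals whose order chains `X`: relations depend only on the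
order type of a tuple. -/
def IsChainCoordinate (L : FirstOrder.Language.{u, v}) {X : Type w} [L.Structure X]
    (φ : X → ℝ) : Prop :=
  Function.Injective φ ∧ ∀ (S T : Set X) (e : S ≃ T),
    (∀ a b : S, φ a < φ b ↔ φ (e a) < φ (e b)) → IsPartialAut L X e

theorem IsChainableByReal.exists_chainCoordinate {A : Set ℝ} (h : IsChainableByReal L X A) :
    ∃ φ : X → ℝ, IsChainCoordinate L φ ∧ range φ = A := by
  obtain ⟨r, ⟨-, hr⟩, ⟨e⟩⟩ := h
  have hlt (x y : X) : (e x : ℝ) < e y ↔ r x y := e.map_rel_iff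
  refine ⟨fun x => e x, ⟨Subtype.val_injective.comp e.injective, fun S T g hg => ?_⟩, ?_⟩
  · exact hr S T g fun a b => by simpa only [hlt] using hg a b
  · ext a
    exact ⟨fun ⟨x, hx⟩ => hx ▸ (e x).2, fun ha => ⟨e.symm ⟨a, ha⟩, by simp⟩⟩

/-- Order isomorphic tuples satisfy the same relations. -/
theorem IsChainCoordinate.relMap_iff {φ : X → ℝ} (hφ : IsChainCoordinate L φ) {k n : ℕ}
    {a b : Fin k → X} (hab : ∀ i j, φ (a i) < φ (a j) ↔ φ (b i) < φ (b j))
    (R : L.Relations n) (s : Fin n → Fin k) :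
    Structure.RelMap R (a ∘ s) ↔ Structure.RelMap R (b ∘ s) := by
  have heq (i j) : a i = a j ↔ b i = b j := by
    rw [← hφ.1.eq_iff, ← hφ.1.eq_iff (a := b i), le_antisymm_iff, le_antisymm_iff, ← not_lt,
      ← not_lt, ← not_lt (a := φ (b i)), ← not_lt (a := φ (b j)), hab, hab]
  -- The tuples may have repetitions; by `heq` the chosen index does not matter.
  let f : range a → range b := fun x => ⟨b x.2.choose, mem_range_self _⟩
  have hf (i) : (f ⟨a i, mem_range_self i⟩ : X) = b i :=
    (heq _ _).1 (mem_range_self (f := a) i).choose_spec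
  have hbij : Function.Bijective f := by
    constructor
    · rintro ⟨_, i, rfl⟩ ⟨_, j, rfl⟩ h
      have := congrArg Subtype.val h
      rw [hf, hf] at this
      exact Subtype.ext ((heq i j).2 this)
    · rintro ⟨_, i, rfl⟩
      exact ⟨⟨a i, mem_range_self i⟩, Subtype.ext (hf i)⟩
  have := hφ.2 _ _ (Equiv.ofBijective f hbij) (by
    rintro ⟨_, i, rfl⟩ ⟨_, j, rfl⟩
    simpa only [Equiv.ofBijective_apply, hf] using hab i j) n R
    fun i => ⟨a (s i), mem_range_self _⟩
  simp only [Equiv.ofBijective_apply, hf] at this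
  exact this

theorem strictMono_lt_iff {φ : X → ℝ} {k : ℕ} {a b : Fin k → X}
    (ha : StrictMono (φ ∘ a)) (hb : StrictMono (φ ∘ b)) (i j : Fin k) :
    φ (a i) < φ (a j) ↔ φ (b i) < φ (b j) :=
  ha.lt_iff_lt.trans hb.lt_iff_lt.symm

/-- If the relations are invariant under the adjacent transpositions of increasing tuples, then the
structure is constant. -/
theorem IsChainCoordinate.isConstant [L.IsRelational] {φ : X → ℝ} (hφ : IsChainCoordinate L φ)
    (h : ∀ (k n : ℕ) (R : L.Relations n) (s : Fin n → Fin (k + 1)) (j : Fin k),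
      ∃ a : Fin (k + 1) → X, StrictMono (φ ∘ a) ∧
        (Structure.RelMap R (a ∘ s) ↔
          Structure.RelMap R (a ∘ Equiv.swap j.castSucc j.succ ∘ s))) :
    IsConstant L X := by
  -- Adjacent transpositions generate the symmetric group; `s` is quantified inside so that
  -- permutations compose. One increasing tuple per transposition suffices, by `relMap_iff`.
  have hperm (k n : ℕ) (R : L.Relations n) (σ : Equiv.Perm (Fin (k + 1))) :
      ∀ (s : Fin n → Fin (k + 1)) (a : Fin (k + 1) → X), StrictMono (φ ∘ a) →
        (Structure.RelMap R (a ∘ s) ↔ Structure.RelMap R (a ∘ σ ∘ s)) := by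
    have hσ : σ ∈ Submonoid.closure
        (Set.range fun i : Fin k ↦ Equiv.swap i.castSucc i.succ) := by
      rw [Equiv.Perm.mclosure_swap_castSucc_succ]
      trivial
    induction hσ using Submonoid.closure_induction with
    | mem σ hσ =>
      obtain ⟨j, rfl⟩ := hσ
      intro s a ha
      obtain ⟨b, hb, hR⟩ := h k n R s j
      rw [hφ.relMap_iff (strictMono_lt_iff ha hb) R s,
        hφ.relMap_iff (strictMono_lt_iff ha hb) R (Equiv.swap j.castSucc j.succ ∘ s)]
      exact hR
    | one => exact fun _ _ _ => Iff.rfl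
    | mul σ τ _ _ hσ hτ =>
      intro s a ha
      rw [hτ s a ha, hσ (τ ∘ s) a ha]
      rfl
  have hinj (k n : ℕ) (R : L.Relations n) (s : Fin n → Fin (k + 1)) (a b : Fin (k + 1) → X)
      (ha : Function.Injective a) (hb : Function.Injective b) :
      Structure.RelMap R (a ∘ s) ↔ Structure.RelMap R (b ∘ s) := by
    have hsort (c : Fin (k + 1) → X) (hc : Function.Injective c) :
        ∃ σ : Equiv.Perm (Fin (k + 1)), StrictMono (φ ∘ (c ∘ σ)) ∧
          (Structure.RelMap R (c ∘ s) ↔ Structure.RelMap R ((c ∘ σ) ∘ s)) := by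
      refine ⟨Tuple.sort (φ ∘ c), ?_, ?_⟩
      · exact (Tuple.monotone_sort (φ ∘ c)).strictMono_of_injective
          ((hφ.1.comp hc).comp (Equiv.injective _))
      · have hm : StrictMono (φ ∘ (c ∘ Tuple.sort (φ ∘ c))) :=
          (Tuple.monotone_sort (φ ∘ c)).strictMono_of_injective
            ((hφ.1.comp hc).comp (Equiv.injective _))
        have := hperm k n R (Tuple.sort (φ ∘ c))⁻¹ s _ hm
        rw [this]
        refine iff_of_eq (congrArg _ ?_)
        ext i
        simp
    obtain ⟨σ, hσ, h1⟩ := hsort a ha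
    obtain ⟨τ, hτ, h2⟩ := hsort b hb
    rw [h1, h2]
    exact hφ.relMap_iff (strictMono_lt_iff hσ hτ) R s
  intro e
  refine ⟨{ e with map_fun' := fun f => isEmptyElim f, map_rel' := fun {n} R x => ?_ }, rfl⟩
  change Structure.RelMap R (e ∘ x) ↔ Structure.RelMap R x
  -- Positive arity makes `range x` nonempty, so that its size has the form `k + 1`.
  obtain _ | n := n
  · rw [Subsingleton.elim (e ∘ x) x]
  obtain ⟨k, hk⟩ : ∃ k, Nat.card (range x) = k + 1 :=
    Nat.exists_eq_succ_of_ne_zero Nat.card_pos.ne'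
  let g : range x ≃ Fin (k + 1) := Finite.equivFinOfCardEq hk
  have hx : x = (fun i => (g.symm i : X)) ∘ fun i => g ⟨x i, mem_range_self i⟩ := by
    ext i
    simp
  have hg : Function.Injective fun i => (g.symm i : X) :=
    Subtype.val_injective.comp g.symm.injective
  rw [hx, ← Function.comp_assoc]
  exact hinj k _ R _ _ _ (e.injective.comp hg) hg

theorem strictMono_insertNth {k : ℕ} {w : Fin k → ℝ} (hw : StrictMono w) {p : Fin (k + 1)} {x : ℝ}
    (h1 : ∀ i : Fin k, i.castSucc < p → w i < x) (h2 : ∀ i : Fin k, p ≤ i.castSucc → x < w i) :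
    StrictMono (p.insertNth (α := fun _ => ℝ) x w) := by
  intro i j hij
  rcases Fin.eq_self_or_eq_succAbove p i with rfl | ⟨i, rfl⟩
  · rcases Fin.eq_self_or_eq_succAbove i j with rfl | ⟨j, rfl⟩
    · exact absurd hij (lt_irrefl _)
    · rw [Fin.insertNth_apply_same, Fin.insertNth_apply_succAbove]
      exact h2 j ((Fin.lt_succAbove_iff_le_castSucc _ _).1 hij)
  · rcases Fin.eq_self_or_eq_succAbove p j with rfl | ⟨j, rfl⟩
    · rw [Fin.insertNth_apply_same, Fin.insertNth_apply_succAbove]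
      exact h1 i ((Fin.succAbove_lt_iff_castSucc_lt _ _).1 hij)
    · rw [Fin.insertNth_apply_succAbove, Fin.insertNth_apply_succAbove]
      exact hw ((Fin.strictMono_succAbove p).lt_iff_lt.1 hij)

/-- This turns moving a value across the entry `w j` into an adjacent transposition of positions. -/
theorem insertNth_castSucc_eq_comp_swap {α : Type u} {k : ℕ} (j : Fin k) (w : Fin k → α) (y : α) :
    j.castSucc.insertNth (α := fun _ => α) y w =
      j.succ.insertNth (α := fun _ => α) y w ∘ Equiv.swap j.castSucc j.succ := by
  ext i
  rcases Fin.eq_self_or_eq_succAbove j.castSucc i with rfl | ⟨i, rfl⟩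
  · simp
  rw [Fin.insertNth_apply_succAbove, Function.comp_apply]
  rcases eq_or_ne i j with rfl | hij
  · rw [Fin.succAbove_castSucc_self, Equiv.swap_apply_right]
    have := Fin.insertNth_apply_succAbove (α := fun _ => α) i.succ y w i
    rw [Fin.succAbove_succ_self] at this
    exact this.symm
  · have h : j.castSucc.succAbove i = j.succ.succAbove i := by
      rcases lt_or_gt_of_ne hij with h | h
      · rw [Fin.succAbove_of_castSucc_lt _ _ h, Fin.succAbove_of_castSucc_lt]
        exact (Fin.castSucc_lt_castSucc_iff.2 h).trans Fin.castSucc_lt_succ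
      · rw [Fin.succAbove_of_le_castSucc _ _ h.le,
          Fin.succAbove_of_le_castSucc _ _ (Fin.succ_le_castSucc_iff.2 h)]
    rw [Equiv.swap_apply_of_ne_of_ne (Fin.succAbove_ne _ _) (h ▸ Fin.succAbove_ne _ _), h,
      Fin.insertNth_apply_succAbove]

/-- If a self-embedding of a chained structure separates the values on a set `V` from the values on
infinitely many two-sided limit points of `V`, then the structure is constant. -/
theorem isConstant_of_infinite [L.IsRelational] {φ : X → ℝ} (hφ : IsChainCoordinate L φ)
    (f : X ↪[L] X) {V W : Set X} (hW : W.Infinite)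
    (hlim : ∀ w ∈ W, (∃ᶠ y in 𝓝[<] φ w, y ∈ φ '' V) ∧ ∃ᶠ y in 𝓝[>] φ w, y ∈ φ '' V)
    (hsep : ∀ w ∈ W, ∀ x ∈ V, ∀ y ∈ V, (φ (f x) < φ (f w) ↔ φ (f y) < φ (f w)) ∧
      (φ (f w) < φ (f x) ↔ φ (f w) < φ (f y))) : IsConstant L X := by
  refine hφ.isConstant fun k n R s j => ?_
  obtain ⟨w, hw, hwW⟩ : ∃ w : Fin k → X, StrictMono (φ ∘ w) ∧ ∀ i, w i ∈ W := by
    obtain ⟨t, htW, htk⟩ := (hW.image hφ.1.injOn).exists_subset_card_eq k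
    choose w hwW hw using fun i : Fin k => htW (t.orderEmbOfFin_mem htk i)
    refine ⟨w, fun a b hab => ?_, hwW⟩
    simpa only [Function.comp, hw] using (t.orderEmbOfFin htk).strictMono hab
  -- `x` and `y` are taken from `V` on either side of `w j`, so close that no other `w i`
  -- intervenes.
  have hx : ∀ᶠ z in 𝓝[<] φ (w j), z < φ (w j) ∧ ∀ i < j, φ (w i) < z :=
    eventually_mem_nhdsWithin.and (eventually_all.2 fun i =>
      eventually_imp_distrib_left.2 fun hij => nhdsWithin_le_nhds (lt_mem_nhds (hw hij)))
  have hy : ∀ᶠ z in 𝓝[>] φ (w j), φ (w j) < z ∧ ∀ i, j < i → z < φ (w i) :=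
    eventually_mem_nhdsWithin.and (eventually_all.2 fun i =>
      eventually_imp_distrib_left.2 fun hij => nhdsWithin_le_nhds (gt_mem_nhds (hw hij)))
  obtain ⟨_, ⟨x, hxV, rfl⟩, hxw, hx⟩ := ((hlim _ (hwW j)).1.and_eventually hx).exists
  obtain ⟨_, ⟨y, hyV, rfl⟩, hyw, hy⟩ := ((hlim _ (hwW j)).2.and_eventually hy).exists
  let ins (p : Fin (k + 1)) (z : X) : Fin (k + 1) → X := p.insertNth (α := fun _ => X) z w
  have hcomp (p z) : φ ∘ ins p z = p.insertNth (α := fun _ => ℝ) (φ z) (φ ∘ w) := by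
    ext i
    rcases Fin.eq_self_or_eq_succAbove p i with rfl | ⟨i, rfl⟩ <;> simp [ins]
  have ha : StrictMono (φ ∘ ins j.castSucc x) := by
    rw [hcomp]
    refine strictMono_insertNth hw (fun i hi => hx i hi) fun i hi => ?_
    exact lt_of_lt_of_le hxw (hw.monotone hi)
  have hb : StrictMono (φ ∘ ins j.succ y) := by
    rw [hcomp]
    refine strictMono_insertNth hw (fun i hi => ?_) fun i hi => hy i ?_
    · exact lt_of_le_of_lt (hw.monotone (Fin.castSucc_lt_succ_iff.1 hi)) hyw
    · exact Fin.succ_le_castSucc_iff.1 hi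
  have hswap : ins j.castSucc y = ins j.succ y ∘ Equiv.swap j.castSucc j.succ :=
    insertNth_castSucc_eq_comp_swap j w y
  have hf {n : ℕ} (R : L.Relations n) (c : Fin n → X) :
      Structure.RelMap R (f ∘ c) ↔ Structure.RelMap R c := f.map_rel R c
  refine ⟨ins j.castSucc x, ha, ?_⟩
  -- By `hsep`, `f x` and `f y` lie on the same side of every `f (w i)`, although `x` and `y` lie on
  -- opposite sides of `w j`.
  have hins : ∀ i i', φ ((f ∘ ins j.castSucc x) i) < φ ((f ∘ ins j.castSucc x) i') ↔
      φ ((f ∘ ins j.castSucc y) i) < φ ((f ∘ ins j.castSucc y) i') := by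
    intro i i'
    rcases Fin.eq_self_or_eq_succAbove j.castSucc i with rfl | ⟨i, rfl⟩ <;>
    rcases Fin.eq_self_or_eq_succAbove j.castSucc i' with rfl | ⟨i', rfl⟩ <;>
    simp only [ins, Function.comp_apply, Fin.insertNth_apply_same, Fin.insertNth_apply_succAbove,
      lt_irrefl]
    · exact (hsep _ (hwW i') x hxV y hyV).1
    · exact (hsep _ (hwW i) x hxV y hyV).2
  rw [hφ.relMap_iff (strictMono_lt_iff ha hb) R (Equiv.swap j.castSucc j.succ ∘ s), ← hf,
    ← Function.comp_assoc, hφ.relMap_iff hins R s, Function.comp_assoc, hf, hswap]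
  rfl

/-- A self-embedding of a nonconstant chained structure has only countably many discontinuities. -/
theorem exists_countable_discontinuities [L.IsRelational] {φ : X → ℝ}
    (hφ : IsChainCoordinate L φ) (hX : ¬ IsConstant L X) (f : X ↪[L] X) {F : ℝ → ℝ}
    (hF : ∀ x, F (φ x) = φ (f x)) :
    ∃ Z : Set ℝ, Z.Countable ∧ ∀ x ∈ range φ, x ∉ Z → ContinuousWithinAt F (range φ) x := by
  have key (V W : Set X) (hsep : ∀ w ∈ W, ∀ x ∈ V, ∀ y ∈ V,
      (φ (f x) < φ (f w) ↔ φ (f y) < φ (f w)) ∧ (φ (f w) < φ (f x) ↔ φ (f w) < φ (f y))) :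
      (φ '' W ∩ closure (φ '' V)).Countable := by
    let W' : Set X := {w ∈ W |
      (∃ᶠ y in 𝓝[<] φ w, y ∈ φ '' V) ∧ ∃ᶠ y in 𝓝[>] φ w, y ∈ φ '' V}
    have hW' : W'.Finite := by
      by_contra hinf
      exact hX (isConstant_of_infinite hφ f hinf (fun w hw => hw.2) fun w hw => hsep w hw.1)
    refine ((hW'.image φ).countable.union (countable_not_two_sided (φ '' V))).mono ?_
    rintro _ ⟨⟨w, hw, rfl⟩, hcl⟩
    by_cases h : (∃ᶠ y in 𝓝[<] φ w, y ∈ φ '' V) ∧ ∃ᶠ y in 𝓝[>] φ w, y ∈ φ '' V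
    · exact Or.inl ⟨w, ⟨hw, h⟩, rfl⟩
    · exact Or.inr ⟨hcl, h⟩
  let B (q : ℚ) : Set X := {x | φ (f x) < q}
  let C (q : ℚ) : Set X := {x | q < φ (f x)}
  -- At a discontinuity some rational `q` strictly separates the value from values at arbitrarily
  -- close points.
  refine ⟨⋃ q : ℚ, φ '' C q ∩ closure (φ '' B q) ∪ φ '' B q ∩ closure (φ '' C q),
    countable_iUnion fun q => (key (B q) (C q) ?_).union (key (C q) (B q) ?_), ?_⟩
  · intro w (hw : q < φ (f w)) x (hx : φ (f x) < q) y (hy : φ (f y) < q)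
    exact ⟨iff_of_true (hx.trans hw) (hy.trans hw),
      iff_of_false (hx.trans hw).not_gt (hy.trans hw).not_gt⟩
  · intro w (hw : φ (f w) < q) x (hx : q < φ (f x)) y (hy : q < φ (f y))
    exact ⟨iff_of_false (hw.trans hx).not_gt (hw.trans hy).not_gt,
      iff_of_true (hw.trans hx) (hw.trans hy)⟩
  rintro _ ⟨x, rfl⟩ hx
  simp only [mem_iUnion, mem_union, not_exists, not_or] at hx
  have hev (V : Set X) (h : φ x ∉ closure (φ '' V)) :
      ∀ᶠ z in 𝓝[range φ] φ x, ∃ y, φ y = z ∧ y ∉ V := by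
    filter_upwards [nhdsWithin_le_nhds (isClosed_closure.isOpen_compl.mem_nhds h),
      self_mem_nhdsWithin]
    rintro _ hz ⟨y, rfl⟩
    exact ⟨y, rfl, fun hy => hz (subset_closure ⟨y, hy, rfl⟩)⟩
  refine tendsto_order.2 ⟨fun a ha => ?_, fun a ha => ?_⟩
  · rw [hF] at ha
    obtain ⟨q, haq, hq⟩ := exists_rat_btwn ha
    filter_upwards [hev (B q) fun h => (hx q).1 ⟨⟨x, hq, rfl⟩, h⟩]
    rintro _ ⟨y, rfl, hy⟩
    rw [hF]
    exact haq.trans_le (not_lt.1 hy)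
  · rw [hF] at ha
    obtain ⟨q, hq, hqa⟩ := exists_rat_btwn ha
    filter_upwards [hev (C q) fun h => (hx q).2 ⟨⟨x, hq, rfl⟩, h⟩]
    rintro _ ⟨y, rfl, hy⟩
    rw [hF]
    exact (not_lt.1 hy).trans_lt hqa

/-- The copies of a nonconstant chained structure contain perfect sets. -/
theorem hasPerfect_copy [L.IsRelational] {φ : X → ℝ} (hφ : IsChainCoordinate L φ)
    (hX : ¬ IsConstant L X) (hP : HasPerfect (range φ)) (Y : Copies L X) :
    HasPerfect (φ '' Y.1) := by
  obtain ⟨_, f, rfl⟩ := Y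
  let F : ℝ → ℝ := Function.extend φ (fun x => φ (f x)) id
  have hF (x) : F (φ x) = φ (f x) := hφ.1.extend_apply _ _ x
  obtain ⟨Z, hZ, hcont⟩ := exists_countable_discontinuities hφ hX f hF
  have hinj : InjOn F (range φ) := by
    rintro _ ⟨x, rfl⟩ _ ⟨y, rfl⟩ h
    rw [hF, hF] at h
    rw [f.injective (hφ.1 h)]
  refine (hP.image hinj hZ hcont).mono ?_
  rintro _ ⟨_, ⟨x, rfl⟩, rfl⟩
  exact ⟨f x, ⟨x, rfl⟩, (hF x).symm⟩

/-- Every perfect subset of a chained structure contains a copy of it. -/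
theorem exists_copy_subset [L.IsRelational] {φ : X → ℝ} (hφ : IsChainCoordinate L φ)
    {S : Set ℝ} (hS : HasPerfect S) (hSφ : S ⊆ range φ) :
    ∃ Y : Copies L X, φ '' Y.1 ⊆ S := by
  obtain ⟨Q, hQ, hne, hQS⟩ := hS
  obtain ⟨g, hg, hgQ⟩ := exists_strictMono_of_perfect hQ hne
  -- In coordinates `f` is `g`, hence increasing, and chaining makes it a self-embedding.
  choose f hf using fun x : X => hSφ (hQS (hgQ (φ x)))
  have hlt (x y) : φ x < φ y ↔ φ (f x) < φ (f y) := by rw [hf, hf, hg.lt_iff_lt]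
  have hinj : Function.Injective f := fun x y h => by
    have := congrArg φ h
    rw [hf, hf] at this
    exact hφ.1 (hg.injective this)
  have hrel {n : ℕ} (R : L.Relations n) (x : Fin n → X) :
      Structure.RelMap R (f ∘ x) ↔ Structure.RelMap R x :=
    (hφ.relMap_iff (a := x) (b := f ∘ x) (fun _ _ => hlt _ _) R id).symm
  refine ⟨⟨range f, ⟨⟨f, hinj⟩, fun h => isEmptyElim h, hrel⟩, rfl⟩, ?_⟩
  rintro _ ⟨_, ⟨x, rfl⟩, rfl⟩
  rw [hf]
  exact hQS (hgQ _)

/-- Nonconstancy enters only to make the map land in the large sets; compatibility and density both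
come from finding a copy inside a given large set. -/
theorem isDenseMap_copies_largeIn [L.IsRelational] {φ : X → ℝ} (hφ : IsChainCoordinate L φ)
    (hX : ¬ IsConstant L X) (hP : HasPerfect (range φ)) :
    IsDenseMap fun Y : Copies L X =>
      (⟨⟨φ '' Y.1, hasPerfect_copy hφ hX hP Y⟩, image_subset_range _ _⟩ : largeIn (range φ)) where
  mono _ _ h := image_mono h
  compat := by
    rintro Y Y' ⟨⟨S, hS⟩, hSφ⟩ hY hY'
    obtain ⟨Y₀, h⟩ := exists_copy_subset hφ hS hSφ
    exact ⟨Y₀, (image_subset_image_iff hφ.1).1 (h.trans hY),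
      (image_subset_image_iff hφ.1).1 (h.trans hY')⟩
  dense := by
    rintro ⟨⟨S, hS⟩, hSφ⟩
    exact exists_copy_subset hφ hS hSφ

end Chains

end CopyAlgebra

theorem theorem7p6 {L : FirstOrder.Language.{u, v}} [L.IsRelational] {X : Type w} [L.Structure X]
    (hX : ¬ CopyAlgebra.IsConstant L X)
    (A : Set ℝ) (hA : ∃ P : Set ℝ, Perfect P ∧ P.Nonempty ∧ P ⊆ A)
    (hchain : CopyAlgebra.IsChainableByReal L X A) :
    Nonempty (CopyAlgebra.CopyCompletion L X ≃o CopyAlgebra.ro CopyAlgebra.Sacks) ∧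
      Nonempty (CopyAlgebra.ro CopyAlgebra.Sacks ≃o
        CopyAlgebra.ro CopyAlgebra.BorelModCountablePos) := by
  obtain ⟨φ, hφ, rfl⟩ := hchain.exists_chainCoordinate
  obtain ⟨e₁⟩ := (CopyAlgebra.isDenseMap_sepQuot (CopyAlgebra.Copies L X)).nonempty_ro_iso
  obtain ⟨e₂⟩ := (CopyAlgebra.isDenseMap_copies_largeIn hφ hX hA).nonempty_ro_iso
  obtain ⟨e₃⟩ := CopyAlgebra.nonempty_ro_sacks_iso_largeIn hA
  exact ⟨⟨e₁.symm.trans (e₂.trans e₃.symm)⟩, CopyAlgebra.isDenseMap_sacks_borel.nonempty_ro_iso⟩
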